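/- Let $m$ be the normalized Lebesgue measure on the unit circle $\mathbb T=\{|z|=1\}$ and $\mathbb D=\{|z|<1\}$. For a nonempty compact set $K\subset\mathbb T$ let $\rho_K(w)$ be the Euclidean distance from $w\in\mathbb C$ to $K$. Let $E,F\subset\mathbb T$ be nonempty compact sets and let $p,q,M>0$. Assume that $$\bigl\|\rho_E^{-p}\rho_F^{-q}\bigr\|_1:=\int_{\mathbb T}\frac{m(d\zeta)}{\rho_E^p(\zeta)\,\rho_F^q(\zeta)}<\infty .$$ Let $v:\mathbb D\to[-\infty,\infty)$ be a subharmonic function with $v(0)\ge 0$ and $$v(z)\le\frac{M}{\rho_E^p(z)\,\rho_F^q(z)},\qquad z\in\mathbb D,$$ and let $\mu=\frac1{2\pi}\Delta v$ (in the sense of distributions on $\mathbb D$) be its Riesz measure. Then $$\int_{\mathbb D}(1-|\lambda|)\,\mu(d\lambda)\le M\,\bigl\|\rho_E^{-p}\rho_F^{-q}\bigr\|_1 .$$ -/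

import Mathlib

open MeasureTheory

noncomputable section

/-- The normalized Lebesgue (arc length) measure `m` on the unit circle, as a Borel measure on `ℂ`. -/
def circleProb : Measure ℂ :=
  (ENNReal.ofReal (2 * Real.pi))⁻¹ •
    (volume.restrict (Set.Ioc (0 : ℝ) (2 * Real.pi))).map (circleMap 0 1)

/-- The integral `∫ f⁺ dν - ∫ f⁻ dν` of an extended real valued function. It is the usual
extended integral whenever one of the two terms is finite, which is always so for a function that
is bounded above with respect to a finite measure. -/
def extIntegral (ν : Measure ℂ) (f : ℂ → EReal) : EReal :=
  ((∫⁻ z, (f z).toENNReal ∂ν : ENNReal) : EReal) - ((∫⁻ z, (-f z).toENNReal ∂ν : ENNReal) : EReal)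

/-- `v` is subharmonic on the open set `U`: it is upper semicontinuous with values in `[-∞, ∞)`, and
its value at the centre of any closed disk in `U` is at most its mean over the boundary circle.
Only the values of `v` on `U` matter. The constant `-∞` is allowed. -/
structure IsSubharmonicOn (v : ℂ → EReal) (U : Set ℂ) : Prop where
  upperSemicontinuousOn : UpperSemicontinuousOn v U
  lt_top : ∀ z ∈ U, v z < ⊤
  le_mean : ∀ (c : ℂ) (r : ℝ), 0 < r → Metric.closedBall c r ⊆ U →
    v c ≤ extIntegral circleProb (fun ζ => v (c + r * ζ))

/-- `μ` is the Riesz measure of `v` on the open set `U`: a Borel measure, finite on the compact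
subsets of `U`, such that `μ = (2π)⁻¹ Δ v` on `U` in the sense of distributions.
Only the restriction of `μ` to `U` matters. (A subharmonic `v ≢ -∞` on a domain is locally
integrable, in particular finite almost everywhere, so `toReal` loses nothing.) -/
structure IsRieszMeasure (v : ℂ → EReal) (U : Set ℂ) (μ : Measure ℂ) : Prop where
  finite_on_compacts : ∀ K : Set ℂ, IsCompact K → K ⊆ U → μ K < ⊤
  integral_eq : ∀ φ : ℂ → ℝ, ContDiff ℝ (⊤ : ℕ∞) φ → HasCompactSupport φ → tsupport φ ⊆ U →
    ∫ z in U, φ z ∂μ =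
      (2 * Real.pi)⁻¹ * ∫ z in U, (v z).toReal * Laplacian.laplacian φ z

/-- The bound `v ≤ M ρ_E⁻ᵖ ρ_F⁻ᑫ` on the unit disk, for a subharmonic function `v`; here
`ρ_K z = Metric.infDist z K`. -/
structure InGrowthClass (E F : Set ℂ) (p q M : ℝ) (v : ℂ → EReal) : Prop where
  subharmonic : IsSubharmonicOn v (Metric.ball 0 1)
  le_majorant : ∀ z ∈ Metric.ball (0 : ℂ) 1,
    v z ≤ ((M / (Metric.infDist z E ^ p * Metric.infDist z F ^ q) : ℝ) : EReal)

/-- `‖ρ_E⁻ᵃ ρ_F⁻ᵇ‖₁ = ∫ ρ_E⁻ᵃ ρ_F⁻ᵇ dm` over the unit circle, with values in `[0, ∞]`; the integrand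
is `+∞` at the zeros of `ρ_E` (if `a > 0`) and of `ρ_F` (if `b > 0`). -/
def singularNorm (E F : Set ℂ) (a b : ℝ) : ENNReal :=
  ∫⁻ ζ, ENNReal.ofReal (Metric.infDist ζ E) ^ (-a) * ENNReal.ofReal (Metric.infDist ζ F) ^ (-b)
    ∂circleProb

end

/-! The Riesz measure is tested against smooth, compactly supported radial functions `φ z =
smoothLog δ (‖z‖ ^ 2)` that approximate the Green function `-log ‖z‖ ≥ 1 - ‖z‖`. In polar
coordinates `∫ φ dμ` becomes an integral of the circle means of `v` against a radial weight
(`setIntegral_ball_mul_radial`).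

The mean over radius `r` is nonnegative, since `v 0 ≥ 0`. It is at most `r ^ (-(p + q) / 2) * M *
‖ρ_E⁻ᵖ ρ_F⁻ᑫ‖₁`, since `ρ_K (r ζ) ≥ √r ρ_K ζ` for `K` on the circle (`sqrt_mul_infDist_le`,
`circle_mean_bounds`). The weight is nonpositive near the origin, so that part is dropped. Near the
unit circle it is bounded by a weight of total mass one. Hence `∫ φ dμ` is at most the bound at `r =
√(1 - 2 * δ)` (`lintegral_smoothLog_le`), and Fatou's lemma as `δ → 0` finishes. -/

/-! ### Laplacian of radial functions. -/

/-- Divergence form of `4 h' + 4 s h''` at `s = ‖z‖ ^ 2`: prescribing the flux `-s h'` prescribes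
the Laplacian. -/
theorem laplacian_comp_norm_sq {h : ℝ → ℝ} (hh : ContDiff ℝ 2 h) (z : ℂ) :
    Laplacian.laplacian (fun w : ℂ => h (‖w‖ ^ 2)) z =
      4 * deriv (fun s => s * deriv h s) (‖z‖ ^ 2) := by
  have hd : Differentiable ℝ h := hh.differentiable (by norm_num)
  have hd' : Differentiable ℝ (deriv h) :=
    (hh.iterate_deriv' 1 1).differentiable (by norm_num)
  have hsq : ∀ w : ℂ, HasFDerivAt (fun w : ℂ => ‖w‖ ^ 2) ((2 : ℝ) • innerSL ℝ w) w := by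
    intro w
    simpa only [two_smul] using (hasStrictFDerivAt_norm_sq w).hasFDerivAt
  have h1 : fderiv ℝ (fun w : ℂ => h (‖w‖ ^ 2)) =
      fun w => deriv h (‖w‖ ^ 2) • ((2 : ℝ) • innerSL ℝ w) := by
    funext w
    exact ((hd _).hasDerivAt.comp_hasFDerivAt w (hsq w)).fderiv
  have h2 : ∀ e : ℂ, iteratedFDeriv ℝ 2 (fun w : ℂ => h (‖w‖ ^ 2)) z ![e, e] =
      deriv h (‖z‖ ^ 2) * (2 * inner ℝ e e) +
        deriv (deriv h) (‖z‖ ^ 2) * (2 * inner ℝ z e) * (2 * inner ℝ z e) := by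
    intro e
    rw [iteratedFDeriv_two_apply, h1]
    have hL : HasFDerivAt (fun w : ℂ => (2 : ℝ) • innerSL ℝ w)
        ((2 : ℝ) • (innerSL ℝ : ℂ →L[ℝ] ℂ →L[ℝ] ℝ)) z :=
      ((2 : ℝ) • (innerSL ℝ : ℂ →L[ℝ] ℂ →L[ℝ] ℝ)).hasFDerivAt
    have hc := (hd' (‖z‖ ^ 2)).hasDerivAt.comp_hasFDerivAt z (hsq z)
    have := (hc.smul hL).fderiv
    simp only [Function.comp_def] at this
    erw [this]
    simp only [add_apply, smul_apply,
      ContinuousLinearMap.smulRight_apply, innerSL_apply_apply, smul_eq_mul, Matrix.cons_val_zero,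
      Matrix.cons_val_one]
    rfl
  have h3 : deriv (fun s => s * deriv h s) (‖z‖ ^ 2) =
      deriv h (‖z‖ ^ 2) + ‖z‖ ^ 2 * deriv (deriv h) (‖z‖ ^ 2) := by
    have := ((hasDerivAt_id (‖z‖ ^ 2)).mul (hd' (‖z‖ ^ 2)).hasDerivAt).deriv
    simpa [Pi.mul_def] using this
  have h4 : ‖z‖ ^ 2 = z.re ^ 2 + z.im ^ 2 := by
    rw [← Complex.normSq_eq_norm_sq, Complex.normSq_apply]; ring
  rw [InnerProductSpace.laplacian_eq_iteratedFDeriv_complexPlane]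
  simp only [h2, h3, Complex.inner, map_one, one_mul, Complex.conj_I]
  simp only [Complex.mul_re, Complex.conj_re, Complex.conj_im, Complex.one_re,
    Complex.I_re, Complex.I_im, Complex.neg_re, Complex.neg_im]
  generalize deriv (deriv h) (‖z‖ ^ 2) = A
  rw [h4]
  ring

/-! ### The radial test functions. -/

/-- Smooth nondecreasing step, `0` for `s ≤ δ` and `1` for `s ≥ 2 * δ`. -/
noncomputable def innerCutoff (δ s : ℝ) : ℝ := Real.smoothTransition (s / δ - 1)

/-- Smooth function equal to `1 / 2` on `[2 * δ, 1 - 2 * δ]` and to `0` off `[δ, 1 - δ]`. -/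
noncomputable def fluxProfile (δ s : ℝ) : ℝ := innerCutoff δ s * innerCutoff δ (1 - s) / 2

/-- The function `h` on `[0, ∞)` with `-s * h' s = fluxProfile δ s`, vanishing at `1`. As `δ → 0`,
the values `h (‖z‖ ^ 2)` approach `- log ‖z‖`. -/
noncomputable def smoothLog (δ s : ℝ) : ℝ := ∫ t in s..1, fluxProfile δ t / t

variable {δ : ℝ}

theorem innerCutoff_nonneg (s : ℝ) : 0 ≤ innerCutoff δ s := Real.smoothTransition.nonneg _

theorem innerCutoff_le_one (s : ℝ) : innerCutoff δ s ≤ 1 := Real.smoothTransition.le_one _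

theorem innerCutoff_of_le (hδ : 0 < δ) {s : ℝ} (hs : s ≤ δ) : innerCutoff δ s = 0 :=
  Real.smoothTransition.zero_of_nonpos (by rw [sub_nonpos, div_le_one hδ]; exact hs)

theorem innerCutoff_of_ge (hδ : 0 < δ) {s : ℝ} (hs : 2 * δ ≤ s) : innerCutoff δ s = 1 :=
  Real.smoothTransition.one_of_one_le (by
    have := (le_div_iff₀ hδ).2 hs
    linarith)

theorem innerCutoff_monotone (hδ : 0 < δ) : Monotone (innerCutoff δ) := fun s t hst =>
  Real.smoothTransition.monotone (by gcongr)

theorem contDiff_innerCutoff : ContDiff ℝ (⊤ : ℕ∞) (innerCutoff δ) :=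
  Real.smoothTransition.contDiff.comp ((contDiff_id.div_const δ).sub contDiff_const)

theorem deriv_innerCutoff_nonneg (hδ : 0 < δ) (s : ℝ) : 0 ≤ deriv (innerCutoff δ) s :=
  (innerCutoff_monotone hδ).deriv_nonneg

theorem deriv_innerCutoff_of_gt (hδ : 0 < δ) {s : ℝ} (hs : 2 * δ < s) :
    deriv (innerCutoff δ) s = 0 := by
  have : innerCutoff δ =ᶠ[nhds s] fun _ => 1 := by
    filter_upwards [lt_mem_nhds hs] with t ht using innerCutoff_of_ge hδ ht.le
  rw [this.deriv_eq, deriv_const]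

theorem contDiff_fluxProfile : ContDiff ℝ (⊤ : ℕ∞) (fluxProfile δ) :=
  (contDiff_innerCutoff.mul
    (contDiff_innerCutoff.comp (contDiff_const.sub contDiff_id))).div_const 2

theorem continuous_deriv_fluxProfile : Continuous (deriv (fluxProfile δ)) :=
  (contDiff_fluxProfile (δ := δ)).continuous_deriv (by simp)

theorem fluxProfile_nonneg (s : ℝ) : 0 ≤ fluxProfile δ s :=
  div_nonneg (mul_nonneg (innerCutoff_nonneg _) (innerCutoff_nonneg _)) two_pos.le

theorem fluxProfile_of_le (hδ : 0 < δ) {s : ℝ} (hs : s ≤ δ) : fluxProfile δ s = 0 := by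
  simp [fluxProfile, innerCutoff_of_le hδ hs]

theorem fluxProfile_of_ge (hδ : 0 < δ) {s : ℝ} (hs : 1 - δ ≤ s) : fluxProfile δ s = 0 := by
  simp [fluxProfile, innerCutoff_of_le hδ (show 1 - s ≤ δ by linarith)]

theorem fluxProfile_eq_half (hδ : 0 < δ) {s : ℝ} (hs : 2 * δ ≤ s) (hs' : s ≤ 1 - 2 * δ) :
    fluxProfile δ s = 1 / 2 := by
  simp [fluxProfile, innerCutoff_of_ge hδ hs,
    innerCutoff_of_ge hδ (show 2 * δ ≤ 1 - s by linarith)]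

theorem deriv_fluxProfile (s : ℝ) :
    deriv (fluxProfile δ) s = (deriv (innerCutoff δ) s * innerCutoff δ (1 - s) -
      innerCutoff δ s * deriv (innerCutoff δ) (1 - s)) / 2 := by
  have hd : Differentiable ℝ (innerCutoff δ) := contDiff_innerCutoff.differentiable (by simp)
  have h1 : HasDerivAt (fun t => innerCutoff δ (1 - t)) (-deriv (innerCutoff δ) (1 - s)) s := by
    simpa using (hd (1 - s)).hasDerivAt.comp_const_sub 1 s
  have := (((hd s).hasDerivAt.mul h1).div_const 2).deriv
  simp only [Pi.mul_def] at this
  refine this.trans ?_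
  ring

theorem deriv_fluxProfile_of_lt (hδ : 0 < δ) {s : ℝ} (hs : s < δ) :
    deriv (fluxProfile δ) s = 0 := by
  have : fluxProfile δ =ᶠ[nhds s] fun _ => 0 := by
    filter_upwards [gt_mem_nhds hs] with t ht using fluxProfile_of_le hδ ht.le
  rw [this.deriv_eq, deriv_const]

/-- Only the outer transition of the profile contributes negatively to its derivative. -/
theorem neg_deriv_fluxProfile_le (hδ : 0 < δ) (s : ℝ) :
    -deriv (fluxProfile δ) s ≤ deriv (innerCutoff δ) (1 - s) / 2 := by
  rw [deriv_fluxProfile]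
  have h1 := mul_nonneg (deriv_innerCutoff_nonneg hδ s) (innerCutoff_nonneg (δ := δ) (1 - s))
  have h2 := mul_le_mul_of_nonneg_right (innerCutoff_le_one (δ := δ) s)
    (deriv_innerCutoff_nonneg hδ (1 - s))
  linarith

/-- The profile vanishes near `0`, so the division creates no singularity. -/
theorem contDiff_fluxProfile_div (hδ : 0 < δ) :
    ContDiff ℝ (⊤ : ℕ∞) (fun t => fluxProfile δ t / t) := by
  rw [contDiff_iff_contDiffAt]
  intro t
  rcases eq_or_ne t 0 with rfl | ht
  · have : (fun t => fluxProfile δ t / t) =ᶠ[nhds 0] fun _ => 0 := by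
      filter_upwards [gt_mem_nhds hδ] with t ht
      simp [fluxProfile_of_le hδ (le_of_lt ht)]
    exact contDiffAt_const.congr_of_eventuallyEq this
  · exact contDiff_fluxProfile.contDiffAt.div contDiffAt_id ht

theorem hasDerivAt_smoothLog (hδ : 0 < δ) (s : ℝ) :
    HasDerivAt (smoothLog δ) (-(fluxProfile δ s / s)) s := by
  have hc := (contDiff_fluxProfile_div hδ).continuous
  exact intervalIntegral.integral_hasDerivAt_left (hc.intervalIntegrable _ _)
    (hc.stronglyMeasurableAtFilter _ _) hc.continuousAt

theorem deriv_smoothLog (hδ : 0 < δ) :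
    deriv (smoothLog δ) = fun s => -(fluxProfile δ s / s) :=
  funext fun s => (hasDerivAt_smoothLog hδ s).deriv

theorem contDiff_smoothLog (hδ : 0 < δ) : ContDiff ℝ (⊤ : ℕ∞) (smoothLog δ) := by
  refine contDiff_infty_iff_deriv.2 ⟨fun s => (hasDerivAt_smoothLog hδ s).differentiableAt, ?_⟩
  rw [deriv_smoothLog hδ]
  exact (contDiff_fluxProfile_div hδ).neg

theorem smoothLog_of_ge (hδ : 0 < δ) {s : ℝ} (hs : 1 - δ ≤ s) : smoothLog δ s = 0 := by
  refine intervalIntegral.integral_zero_ae (Filter.Eventually.of_forall fun t ht => ?_)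
  rw [fluxProfile_of_ge hδ, zero_div]
  rcases Set.mem_uIoc.1 ht with h | h <;> linarith [h.1]

theorem smoothLog_nonneg {s : ℝ} (hs : 0 ≤ s) (hs1 : s ≤ 1) : 0 ≤ smoothLog δ s :=
  intervalIntegral.integral_nonneg hs1 fun t ht =>
    div_nonneg (fluxProfile_nonneg t) (hs.trans ht.1)

/-- On the plateau the integrand is `1 / (2 t) ≥ 1 / (2 √t)`, the derivative of `√t`, because `t ≤
1`. Starting at `s + 2 * δ` keeps `t` in the plateau even for `s = 0`. At `s = ‖z‖ ^ 2` the bound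
tends to `1 - ‖z‖`. -/
theorem sqrt_sub_sqrt_le_smoothLog (hδ : 0 < δ) {s : ℝ} (hs : 0 ≤ s) (hs1 : s ≤ 1) :
    √(1 - 2 * δ) - √(s + 2 * δ) ≤ smoothLog δ s := by
  rcases le_total (1 - 2 * δ) (s + 2 * δ) with h | h
  · exact (sub_nonpos.2 (Real.sqrt_le_sqrt h)).trans (smoothLog_nonneg hs hs1)
  have hc := (contDiff_fluxProfile_div hδ).continuous
  have hpos : ∀ t, s + 2 * δ ≤ t → 0 < t := fun t ht => by linarith
  have hint : IntervalIntegrable (fun t => 1 / (2 * √t)) volume (s + 2 * δ) (1 - 2 * δ) := by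
    refine ContinuousOn.intervalIntegrable fun t ht => ContinuousAt.continuousWithinAt ?_
    rw [Set.uIcc_of_le h] at ht
    have := Real.sqrt_pos.2 (hpos t ht.1)
    exact continuousAt_const.div (by fun_prop) (by positivity)
  calc √(1 - 2 * δ) - √(s + 2 * δ)
      = ∫ t in (s + 2 * δ)..(1 - 2 * δ), 1 / (2 * √t) := by
        refine (intervalIntegral.integral_eq_sub_of_hasDerivAt (fun t ht => ?_) hint).symm
        rw [Set.uIcc_of_le h] at ht
        exact Real.hasDerivAt_sqrt (hpos t ht.1).ne'
    _ ≤ ∫ t in (s + 2 * δ)..(1 - 2 * δ), fluxProfile δ t / t := by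
        refine intervalIntegral.integral_mono_on h hint (hc.intervalIntegrable _ _) fun t ht => ?_
        have h0 := hpos t ht.1
        rw [fluxProfile_eq_half hδ (by linarith [ht.1]) ht.2, div_div]
        refine one_div_le_one_div_of_le (by positivity) ?_
        have : t * 1 ≤ √t * √t * 1 := by rw [Real.mul_self_sqrt h0.le]
        nlinarith [Real.sqrt_pos.2 h0, Real.sqrt_le_one.2 (show t ≤ 1 by linarith [ht.2])]
    _ ≤ smoothLog δ s := by
        refine intervalIntegral.integral_mono_interval (by linarith) h (by linarith) ?_
          (hc.intervalIntegrable _ _)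
        refine (ae_restrict_iff' measurableSet_Ioc).2 (Filter.Eventually.of_forall fun t ht => ?_)
        exact div_nonneg (fluxProfile_nonneg t) (hs.trans ht.1.le)

theorem laplacian_smoothLog (hδ : 0 < δ) (z : ℂ) :
    Laplacian.laplacian (fun w : ℂ => smoothLog δ (‖w‖ ^ 2)) z =
      -4 * deriv (fluxProfile δ) (‖z‖ ^ 2) := by
  rw [laplacian_comp_norm_sq (mod_cast contDiff_infty.1 (contDiff_smoothLog hδ) 2),
    deriv_smoothLog hδ]
  have : (fun s => s * -(fluxProfile δ s / s)) = fun s => -fluxProfile δ s := by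
    funext s
    rcases eq_or_ne s 0 with rfl | hs
    · simp [fluxProfile_of_le hδ hδ.le]
    · field_simp
  rw [this, deriv.fun_neg]
  ring

theorem contDiff_smoothLog_norm_sq (hδ : 0 < δ) :
    ContDiff ℝ (⊤ : ℕ∞) (fun w : ℂ => smoothLog δ (‖w‖ ^ 2)) :=
  (contDiff_smoothLog hδ).comp (contDiff_norm_sq ℝ)

theorem tsupport_smoothLog_norm_sq (hδ : 0 < δ) :
    tsupport (fun w : ℂ => smoothLog δ (‖w‖ ^ 2)) ⊆ Metric.closedBall 0 √(1 - δ) := by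
  refine closure_minimal (fun w hw => ?_) Metric.isClosed_closedBall
  rw [mem_closedBall_zero_iff]
  refine Real.le_sqrt_of_sq_le (le_of_not_ge fun h => hw (smoothLog_of_ge hδ h))

theorem closedBall_sqrt_subset_ball (hδ : 0 < δ) :
    Metric.closedBall (0 : ℂ) √(1 - δ) ⊆ Metric.ball 0 1 :=
  Metric.closedBall_subset_ball ((Real.sqrt_lt' one_pos).2 (by linarith))

theorem hasCompactSupport_smoothLog_norm_sq (hδ : 0 < δ) :
    HasCompactSupport (fun w : ℂ => smoothLog δ (‖w‖ ^ 2)) :=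
  (isCompact_closedBall _ _).of_isClosed_subset (isClosed_tsupport _)
    (tsupport_smoothLog_norm_sq hδ)

/-- The outer transition carries mass exactly one, which gives the sharp constant in the final
inequality. -/
theorem integral_deriv_innerCutoff (hδ : 0 < δ) (hδ' : 2 * δ ≤ 1) :
    ∫ r in (0 : ℝ)..1, r * (2 * deriv (innerCutoff δ) (1 - r ^ 2)) = 1 := by
  have hd : Differentiable ℝ (innerCutoff δ) := contDiff_innerCutoff.differentiable (by simp)
  have hcd : Continuous (deriv (innerCutoff δ)) :=
    (contDiff_innerCutoff (δ := δ)).continuous_deriv (by simp)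
  have hF : ∀ r : ℝ, HasDerivAt (fun r => -innerCutoff δ (1 - r ^ 2))
      (r * (2 * deriv (innerCutoff δ) (1 - r ^ 2))) r := by
    intro r
    have h1 : HasDerivAt (fun r : ℝ => 1 - r ^ 2) (-(2 * r)) r := by
      simpa using (hasDerivAt_pow 2 r).const_sub 1
    refine (((hd _).hasDerivAt.comp r h1).neg).congr_deriv ?_
    ring
  rw [intervalIntegral.integral_eq_sub_of_hasDerivAt (fun r _ => hF r)
    (Continuous.intervalIntegrable (by fun_prop) _ _)]
  simp [innerCutoff_of_le hδ hδ.le, innerCutoff_of_ge hδ hδ']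

/-! ### Integration over the unit circle and extended integrals. -/

/-- Both intervals are, up to null sets, fundamental domains for translation by `2 π`. The symmetric
one matches `polarCoord`. -/
theorem circleProb_eq_smul_map_restrict_Ioo :
    circleProb = (ENNReal.ofReal (2 * Real.pi))⁻¹ •
      (volume.restrict (Set.Ioo (-Real.pi) Real.pi)).map (circleMap 0 1) := by
  have hm : Measurable (circleMap 0 1) := (continuous_circleMap 0 1).measurable
  rw [circleProb, Measure.restrict_congr_set Ioo_ae_eq_Ioc]
  congr 1
  ext A hA
  have h1 := isAddFundamentalDomain_Ioc Real.two_pi_pos 0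
  have h2 := isAddFundamentalDomain_Ioc Real.two_pi_pos (-Real.pi)
  rw [zero_add] at h1
  rw [show -Real.pi + 2 * Real.pi = Real.pi by ring] at h2
  rw [Measure.map_apply hm hA, Measure.map_apply hm hA, Measure.restrict_apply (hm hA),
    Measure.restrict_apply (hm hA)]
  refine h1.measure_set_eq h2 (hm hA) fun g => ?_
  obtain ⟨_, n, rfl⟩ := g
  ext θ
  have := (periodic_circleMap 0 1).zsmul n θ
  rw [add_comm] at this
  simp only [Set.mem_preimage, AddSubgroup.vadd_def, vadd_eq_add]
  rw [this]

instance : IsProbabilityMeasure circleProb := by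
  constructor
  have hm : Measurable (circleMap 0 1) := (continuous_circleMap 0 1).measurable
  rw [circleProb, Measure.smul_apply, Measure.map_apply hm MeasurableSet.univ, Set.preimage_univ,
    Measure.restrict_apply_univ, Real.volume_Ioc, sub_zero, smul_eq_mul]
  exact ENNReal.inv_mul_cancel (by simp [Real.pi_pos]) ENNReal.ofReal_ne_top

theorem ae_circleProb_norm_eq_one : ∀ᵐ ζ ∂circleProb, ‖ζ‖ = 1 := by
  refine Measure.ae_smul_measure ?_ _
  rw [ae_map_iff (continuous_circleMap 0 1).measurable.aemeasurable
    (measurableSet_eq_fun measurable_norm measurable_const)]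
  exact Filter.Eventually.of_forall fun θ => by simp

theorem integral_circleProb {f : ℂ → ℝ} (hf : Measurable f) :
    ∫ ζ, f ζ ∂circleProb =
      (2 * Real.pi)⁻¹ * ∫ θ in Set.Ioo (-Real.pi) Real.pi, f (circleMap 0 1 θ) := by
  rw [circleProb_eq_smul_map_restrict_Ioo, integral_smul_measure,
    integral_map (continuous_circleMap 0 1).measurable.aemeasurable hf.aestronglyMeasurable,
    ENNReal.toReal_inv, ENNReal.toReal_ofReal Real.two_pi_pos.le, smul_eq_mul]

theorem MeasureTheory.Integrable.integrableOn_comp_circleMap {f : ℂ → ℝ} (hm : Measurable f)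
    (hf : Integrable f circleProb) :
    IntegrableOn (fun θ => f (circleMap 0 1 θ)) (Set.Ioo (-Real.pi) Real.pi) := by
  rw [circleProb_eq_smul_map_restrict_Ioo,
    integrable_smul_measure (ENNReal.inv_ne_zero.2 ENNReal.ofReal_ne_top)
      (by simp [Real.pi_pos]),
    integrable_map_measure hm.aestronglyMeasurable
      (continuous_circleMap 0 1).measurable.aemeasurable] at hf
  exact hf

/-- If the positive part has a finite integral and the extended integral is nonnegative, then the
function is integrable, with the expected bounds. -/
theorem integrable_toReal_of_extIntegral_nonneg {ν : Measure ℂ} {f : ℂ → EReal}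
    (hf : AEMeasurable f ν) {B : ENNReal} (hB : B < ⊤) (hpos : ∫⁻ z, (f z).toENNReal ∂ν ≤ B)
    (h0 : 0 ≤ extIntegral ν f) :
    Integrable (fun z => (f z).toReal) ν ∧ 0 ≤ ∫ z, (f z).toReal ∂ν ∧
      ∫ z, (f z).toReal ∂ν ≤ B.toReal ∧ ∫ z, ‖(f z).toReal‖ ∂ν ≤ 2 * B.toReal := by
  set P := ∫⁻ z, (f z).toENNReal ∂ν with hP
  set N := ∫⁻ z, (-f z).toENNReal ∂ν with hN
  have hPtop : P < ⊤ := hpos.trans_lt hB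
  -- Finiteness of `P` excludes `⊤ - ⊤`, so the sign of the difference controls the negative part.
  have hNP : N ≤ P := by
    have := (EReal.sub_nonneg (Or.inl (by simpa using hPtop.ne))
      (Or.inl (EReal.coe_ennreal_ne_bot _))).1 h0
    exact EReal.coe_ennreal_le_coe_ennreal_iff.1 this
  have hNtop : N < ⊤ := hNP.trans_lt hPtop
  have hmP : AEMeasurable (fun z => (f z).toENNReal) ν :=
    measurable_ereal_toENNReal.comp_aemeasurable hf
  have hmN : AEMeasurable (fun z => (-f z).toENNReal) ν :=
    measurable_ereal_toENNReal.comp_aemeasurable hf.neg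
  have hm : AEMeasurable (fun z => (f z).toReal) ν := measurable_ereal_toReal.comp_aemeasurable hf
  have hPe : ∫⁻ z, ENNReal.ofReal (f z).toReal ∂ν = P := by
    refine lintegral_congr_ae ?_
    filter_upwards [ae_lt_top' hmP hPtop.ne] with z hz
    rw [EReal.toENNReal_of_ne_top]
    rintro h
    simp [h] at hz
  have hNe : ∫⁻ z, ENNReal.ofReal (-(f z).toReal) ∂ν = N := by
    refine lintegral_congr_ae ?_
    filter_upwards [ae_lt_top' hmN hNtop.ne] with z hz
    rw [EReal.toENNReal_of_ne_top, EReal.toReal_neg_eq]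
    rintro h
    simp [h] at hz
  have habs : ∫⁻ z, ‖(f z).toReal‖ₑ ∂ν = P + N := by
    rw [← hPe, ← hNe, ← lintegral_add_left' hm.ennreal_ofReal]
    refine lintegral_congr fun z => ?_
    rw [← ofReal_norm, Real.norm_eq_abs]
    rcases le_total 0 (f z).toReal with h | h
    · rw [abs_of_nonneg h, ENNReal.ofReal_of_nonpos (neg_nonpos.2 h), add_zero]
    · rw [abs_of_nonpos h, ENNReal.ofReal_of_nonpos h, zero_add]
  have hint : Integrable (fun z => (f z).toReal) ν := by
    refine ⟨hm.aestronglyMeasurable, ?_⟩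
    rw [HasFiniteIntegral, habs]
    exact ENNReal.add_lt_top.2 ⟨hPtop, hNtop⟩
  have hPN : N.toReal ≤ P.toReal := ENNReal.toReal_mono hPtop.ne hNP
  have hPB : P.toReal ≤ B.toReal := ENNReal.toReal_mono hB.ne hpos
  have heq := integral_eq_lintegral_pos_part_sub_lintegral_neg_part hint
  rw [hPe, hNe] at heq
  refine ⟨hint, ?_, ?_, ?_⟩
  · rw [heq]; linarith
  · rw [heq]; linarith [ENNReal.toReal_nonneg (a := N)]
  · rw [integral_norm_eq_lintegral_enorm hm.aestronglyMeasurable, habs,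
      ENNReal.toReal_add hPtop.ne hNtop.ne]
    linarith

/-! ### Polar coordinates. -/

/-- Integration over the unit disk against a radial weight, through circle means. -/
theorem setIntegral_ball_mul_radial {w : ℂ → ℝ} {g : ℝ → ℝ} (hw : Measurable w)
    (hg : Measurable g) {C : ℝ}
    (hint : ∀ r ∈ Set.Ioo (0 : ℝ) 1, Integrable (fun ζ => w (r * ζ)) circleProb)
    (hC : ∀ r ∈ Set.Ioo (0 : ℝ) 1, |g r| * ∫ ζ, ‖w (r * ζ)‖ ∂circleProb ≤ C) :
    IntegrableOn (fun r => r * (g r * ∫ ζ, w (r * ζ) ∂circleProb)) (Set.Ioo (0 : ℝ) 1) ∧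
    ∫ z in Metric.ball (0 : ℂ) 1, w z * g ‖z‖ =
      2 * Real.pi * ∫ r in Set.Ioo (0 : ℝ) 1, r * (g r * ∫ ζ, w (r * ζ) ∂circleProb) := by
  set I := Set.Ioo (0 : ℝ) 1
  set J := Set.Ioo (-Real.pi) Real.pi
  set H : ℝ × ℝ → ℝ := fun p => p.1 * (w (p.1 * circleMap 0 1 p.2) * g p.1) with hH
  have hc : Measurable (circleMap 0 1) := (continuous_circleMap 0 1).measurable
  have hwr : ∀ r : ℝ, Measurable fun ζ : ℂ => w (r * ζ) := fun r =>
    hw.comp (measurable_const.mul measurable_id)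
  have hHm : Measurable H := by
    refine measurable_fst.mul (Measurable.mul (hw.comp ?_) (hg.comp measurable_fst))
    exact (Complex.measurable_ofReal.comp measurable_fst).mul (hc.comp measurable_snd)
  have hmean : ∀ r : ℝ, ∫ θ in J, H (r, θ) =
      2 * Real.pi * (r * (g r * ∫ ζ, w (r * ζ) ∂circleProb)) := by
    intro r
    rw [integral_circleProb (hwr r)]
    simp only [hH]
    rw [integral_const_mul, integral_mul_const]
    field_simp
    ring
  have hnorm : ∀ r ∈ I, ∫ θ in J, ‖H (r, θ)‖ =
      2 * Real.pi * (r * (|g r| * ∫ ζ, ‖w (r * ζ)‖ ∂circleProb)) := by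
    intro r hr
    rw [integral_circleProb (hwr r).norm]
    simp only [hH, norm_mul]
    rw [integral_const_mul, integral_mul_const, Real.norm_of_nonneg hr.1.le, Real.norm_eq_abs (g r)]
    field_simp
    ring
  have hHint : Integrable H ((volume.restrict I).prod (volume.restrict J)) := by
    rw [integrable_prod_iff hHm.aestronglyMeasurable]
    refine ⟨(ae_restrict_iff' measurableSet_Ioo).2 (Filter.Eventually.of_forall fun r hr => ?_), ?_⟩
    · simp only [hH]
      exact (((hint r hr).integrableOn_comp_circleMap (hwr r)).mul_const _).const_mul _
    · refine Measure.integrableOn_of_bounded (M := 2 * Real.pi * C) (by simp [I])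
        hHm.aestronglyMeasurable.norm.integral_prod_right' ?_
      refine (ae_restrict_iff' measurableSet_Ioo).2 (Filter.Eventually.of_forall fun r hr => ?_)
      rw [hnorm r hr]
      have h0 : 0 ≤ |g r| * ∫ ζ, ‖w (r * ζ)‖ ∂circleProb :=
        mul_nonneg (abs_nonneg _) (integral_nonneg fun _ => norm_nonneg _)
      rw [Real.norm_of_nonneg (mul_nonneg Real.two_pi_pos.le (mul_nonneg hr.1.le h0))]
      refine mul_le_mul_of_nonneg_left ?_ Real.two_pi_pos.le
      exact (mul_le_of_le_one_left h0 hr.2.le).trans (hC r hr)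
  have hpolar : ∀ p : ℝ × ℝ, Complex.polarCoord.symm p = p.1 * circleMap 0 1 p.2 := by
    intro p
    rw [Complex.polarCoord_symm_apply, circleMap_zero, Complex.ofReal_one, one_mul,
      Complex.exp_mul_I, Complex.ofReal_cos, Complex.ofReal_sin]
  have hsub : I ×ˢ J ⊆ polarCoord.target := Set.prod_mono Set.Ioo_subset_Ioi_self subset_rfl
  have hIJ : MeasurableSet (I ×ˢ J) := measurableSet_Ioo.prod measurableSet_Ioo
  have hnm : ∀ p : ℝ × ℝ, 0 < p.1 → ‖Complex.polarCoord.symm p‖ = p.1 := by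
    intro p hp
    rw [hpolar, norm_mul, norm_circleMap_zero, abs_one, mul_one, Complex.norm_real,
      Real.norm_of_nonneg hp.le]
  constructor
  · have := hHint.integral_prod_left
    simp only [hmean] at this
    refine (this.const_mul (2 * Real.pi)⁻¹).congr (Filter.Eventually.of_forall fun r => ?_)
    simp only
    field_simp
  · rw [← integral_indicator measurableSet_ball, ← Complex.integral_comp_polarCoord_symm,
      setIntegral_eq_of_subset_of_forall_sdiff_eq_zero polarCoord.open_target.measurableSet hsub,
      setIntegral_congr_fun (g := H) hIJ,
      Measure.volume_eq_prod, setIntegral_prod, ← integral_const_mul]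
    · simp only [hmean]
    · rwa [IntegrableOn, ← Measure.prod_restrict]
    · intro p hp
      have h1 := hnm p hp.1.1
      have h2 : Complex.polarCoord.symm p ∈ Metric.ball (0 : ℂ) 1 := by
        rw [mem_ball_zero_iff, h1]; exact hp.1.2
      beta_reduce
      rw [Set.indicator_of_mem h2, h1]
      simp only [hH, hpolar, smul_eq_mul]
    · intro p hp
      have h1 := hnm p hp.1.1
      have h2 : Complex.polarCoord.symm p ∉ Metric.ball (0 : ℂ) 1 := by
        rw [mem_ball_zero_iff, h1]
        exact fun h => hp.2 ⟨⟨hp.1.1, h⟩, hp.1.2⟩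
      simp only [Set.indicator_of_notMem h2, smul_zero]

/-! ### Circle means below the majorant. -/

theorem UpperSemicontinuousOn.measurable_indicator {v : ℂ → EReal} {s : Set ℂ}
    (hv : UpperSemicontinuousOn v s) (hs : MeasurableSet s) : Measurable (s.indicator v) := by
  refine measurable_of_Iio fun b => ?_
  obtain ⟨u, hu, hub⟩ := upperSemicontinuousOn_iff_preimage_Iio.1 hv b
  have : s.indicator v ⁻¹' Set.Iio b = (s ∩ u) ∪ (sᶜ ∩ {_z | (0 : EReal) < b}) := by
    rw [← hub]
    ext z
    by_cases hz : z ∈ s <;> simp [hz]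
  rw [this]
  exact (hs.inter hu.measurableSet).union (hs.compl.inter (MeasurableSet.const _))

/-- For unit `ζ` and `e`, `‖r ζ - e‖ ^ 2 - r ‖ζ - e‖ ^ 2 = (1 - r) ^ 2 ≥ 0`. -/
theorem sqrt_mul_infDist_le {E : Set ℂ} (hne : E.Nonempty) (hE : E ⊆ Metric.sphere (0 : ℂ) 1)
    {r : ℝ} (hr : 0 ≤ r) {ζ : ℂ} (hζ : ‖ζ‖ = 1) :
    √r * Metric.infDist ζ E ≤ Metric.infDist (r * ζ) E := by
  rw [Metric.le_infDist hne]
  intro e he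
  have he1 : ‖e‖ = 1 := by simpa using hE he
  have key : r * ‖ζ - e‖ ^ 2 ≤ ‖r * ζ - e‖ ^ 2 := by
    have h1 : ζ.re ^ 2 + ζ.im ^ 2 = 1 := by
      have := Complex.sq_norm ζ
      rw [hζ, Complex.normSq_apply] at this
      linarith
    have h2 : e.re ^ 2 + e.im ^ 2 = 1 := by
      have := Complex.sq_norm e
      rw [he1, Complex.normSq_apply] at this
      linarith
    rw [Complex.sq_norm, Complex.sq_norm, Complex.normSq_apply, Complex.normSq_apply]
    simp only [Complex.sub_re, Complex.sub_im, Complex.re_ofReal_mul, Complex.im_ofReal_mul]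
    nlinarith [sq_nonneg (1 - r)]
  calc √r * Metric.infDist ζ E ≤ √r * dist ζ e := by
        gcongr
        exact Metric.infDist_le_dist_of_mem he
    _ = √(r * ‖ζ - e‖ ^ 2) := by
        rw [Real.sqrt_mul hr, Real.sqrt_sq (norm_nonneg _), Complex.dist_eq]
    _ ≤ √(‖r * ζ - e‖ ^ 2) := Real.sqrt_le_sqrt key
    _ = dist (r * ζ) e := by rw [Real.sqrt_sq (norm_nonneg _), Complex.dist_eq]

theorem infDist_pos_of_norm_lt_one {E : Set ℂ} (hne : E.Nonempty)
    (hE : E ⊆ Metric.sphere (0 : ℂ) 1) {z : ℂ} (hz : ‖z‖ < 1) : 0 < Metric.infDist z E := by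
  refine (sub_pos.2 hz).trans_le ((Metric.le_infDist hne).2 fun e he => ?_)
  have he1 : ‖e‖ = 1 := by simpa using hE he
  rw [dist_comm, Complex.dist_eq, ← he1]
  exact norm_sub_norm_le e z

/-- In `ENNReal` the right side is `⊤` where `infDist ζ E = 0`, so such `ζ` need no exclusion. -/
theorem ofReal_infDist_rpow_le {E : Set ℂ} (hne : E.Nonempty) (hE : E ⊆ Metric.sphere (0 : ℂ) 1)
    {a r : ℝ} (ha : 0 < a) (hr : 0 < r) (hr1 : r < 1) {ζ : ℂ} (hζ : ‖ζ‖ = 1) :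
    ENNReal.ofReal ((Metric.infDist (r * ζ) E ^ a)⁻¹) ≤
      ENNReal.ofReal (√r ^ (-a)) * ENNReal.ofReal (Metric.infDist ζ E) ^ (-a) := by
  have hn : ‖(r * ζ : ℂ)‖ < 1 := by
    rwa [norm_mul, hζ, mul_one, Complex.norm_real, Real.norm_of_nonneg hr.le]
  have hp := infDist_pos_of_norm_lt_one hne hE hn
  have hs := Real.sqrt_pos.2 hr
  rw [← Real.rpow_neg hp.le, ← ENNReal.ofReal_rpow_of_pos hp, ← ENNReal.ofReal_rpow_of_pos hs,
    ← ENNReal.mul_rpow_of_ne_top ENNReal.ofReal_ne_top ENNReal.ofReal_ne_top,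
    ← ENNReal.ofReal_mul hs.le, ENNReal.rpow_neg, ENNReal.rpow_neg, ENNReal.inv_le_inv]
  exact ENNReal.rpow_le_rpow (ENNReal.ofReal_le_ofReal (sqrt_mul_infDist_le hne hE hr.le hζ)) ha.le

/-- The mean of the positive part over the circle of radius `r`, for functions below the
majorant. -/
theorem lintegral_toENNReal_le_of_le_majorant {E F : Set ℂ} (hEne : E.Nonempty)
    (hE : E ⊆ Metric.sphere (0 : ℂ) 1) (hFne : F.Nonempty) (hF : F ⊆ Metric.sphere (0 : ℂ) 1)
    {p q M : ℝ} (hp : 0 < p) (hq : 0 < q) (hM : 0 < M) {v : ℂ → EReal}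
    (hv : ∀ z ∈ Metric.ball (0 : ℂ) 1,
      v z ≤ ((M / (Metric.infDist z E ^ p * Metric.infDist z F ^ q) : ℝ) : EReal))
    {r : ℝ} (hr : 0 < r) (hr1 : r < 1) :
    ∫⁻ ζ, (v (r * ζ)).toENNReal ∂circleProb ≤
      ENNReal.ofReal (√r ^ (-(p + q))) * (ENNReal.ofReal M * singularNorm E F p q) := by
  have hs := Real.sqrt_pos.2 hr
  rw [singularNorm, ← mul_assoc, ← lintegral_const_mul' _ _ (by finiteness)]
  refine lintegral_mono_ae ?_
  filter_upwards [ae_circleProb_norm_eq_one] with ζ hζ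
  have hn : (r * ζ : ℂ) ∈ Metric.ball (0 : ℂ) 1 := by
    rwa [mem_ball_zero_iff, norm_mul, hζ, mul_one, Complex.norm_real, Real.norm_of_nonneg hr.le]
  refine (EReal.toENNReal_le_toENNReal (hv _ hn)).trans ?_
  rw [EReal.toENNReal_of_ne_top (EReal.coe_ne_top _), EReal.toReal_coe, div_eq_mul_inv, mul_inv,
    ENNReal.ofReal_mul hM.le,
    ENNReal.ofReal_mul (inv_nonneg.2 (Real.rpow_nonneg Metric.infDist_nonneg _)), neg_add,
    Real.rpow_add hs, ENNReal.ofReal_mul (by positivity)]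
  calc _ ≤ ENNReal.ofReal M * ((ENNReal.ofReal (√r ^ (-p)) *
          ENNReal.ofReal (Metric.infDist ζ E) ^ (-p)) * (ENNReal.ofReal (√r ^ (-q)) *
          ENNReal.ofReal (Metric.infDist ζ F) ^ (-q))) := by
        gcongr
        · exact ofReal_infDist_rpow_le hEne hE hp hr hr1 hζ
        · exact ofReal_infDist_rpow_le hFne hF hq hr hr1 hζ
    _ = _ := by ring

theorem extIntegral_congr_ae {ν : Measure ℂ} {f g : ℂ → EReal} (h : f =ᵐ[ν] g) :
    extIntegral ν f = extIntegral ν g := by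
  have h1 : ∫⁻ z, (f z).toENNReal ∂ν = ∫⁻ z, (g z).toENNReal ∂ν :=
    lintegral_congr_ae (h.mono fun z hz => by simp only [hz])
  have h2 : ∫⁻ z, (-f z).toENNReal ∂ν = ∫⁻ z, (-g z).toENNReal ∂ν :=
    lintegral_congr_ae (h.mono fun z hz => by simp only [hz])
  rw [extIntegral, extIntegral, h1, h2]

/-- The bound on the means of the positive part over the circle of radius `r`. -/
noncomputable def circleMeanBound (E F : Set ℂ) (p q M r : ℝ) : ENNReal :=
  ENNReal.ofReal (√r ^ (-(p + q))) * (ENNReal.ofReal M * singularNorm E F p q)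

section

variable {E F : Set ℂ} {p q M : ℝ}

theorem circleMeanBound_lt_top (hint : singularNorm E F p q < ⊤) (r : ℝ) :
    circleMeanBound E F p q M r < ⊤ :=
  ENNReal.mul_lt_top ENNReal.ofReal_lt_top (ENNReal.mul_lt_top ENNReal.ofReal_lt_top hint)

theorem circleMeanBound_anti (hp : 0 < p) (hq : 0 < q) {r s : ℝ} (hr : 0 < r) (hrs : r ≤ s) :
    circleMeanBound E F p q M s ≤ circleMeanBound E F p q M r := by
  refine mul_le_mul_left (ENNReal.ofReal_le_ofReal ?_) _
  exact Real.rpow_le_rpow_of_nonpos (Real.sqrt_pos.2 hr) (Real.sqrt_le_sqrt hrs) (by linarith)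

theorem circle_mean_bounds (hEne : E.Nonempty)
    (hE : E ⊆ Metric.sphere (0 : ℂ) 1) (hFne : F.Nonempty) (hF : F ⊆ Metric.sphere (0 : ℂ) 1)
    (hp : 0 < p) (hq : 0 < q) (hM : 0 < M) (hint : singularNorm E F p q < ⊤)
    {v : ℂ → EReal} (hv : InGrowthClass E F p q M v) (hv0 : 0 ≤ v 0) {r : ℝ}
    (hr : r ∈ Set.Ioo (0 : ℝ) 1) :
    Integrable (fun ζ => ((Metric.ball (0 : ℂ) 1).indicator v (r * ζ)).toReal) circleProb ∧
      0 ≤ ∫ ζ, ((Metric.ball (0 : ℂ) 1).indicator v (r * ζ)).toReal ∂circleProb ∧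
      ∫ ζ, ((Metric.ball (0 : ℂ) 1).indicator v (r * ζ)).toReal ∂circleProb ≤
        (circleMeanBound E F p q M r).toReal ∧
      ∫ ζ, ‖((Metric.ball (0 : ℂ) 1).indicator v (r * ζ)).toReal‖ ∂circleProb ≤
        2 * (circleMeanBound E F p q M r).toReal := by
  refine integrable_toReal_of_extIntegral_nonneg ?_ (circleMeanBound_lt_top hint r) ?_ ?_
  · exact ((hv.subharmonic.upperSemicontinuousOn.measurable_indicator measurableSet_ball).comp
      (measurable_const.mul measurable_id)).aemeasurable
  · refine lintegral_toENNReal_le_of_le_majorant hEne hE hFne hF hp hq hM (fun z hz => ?_)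
      hr.1 hr.2
    rw [Set.indicator_of_mem hz]
    exact hv.le_majorant z hz
  -- The sub-mean value property is needed only for circles centred at the origin.
  · refine (hv0.trans (hv.subharmonic.le_mean 0 r hr.1
      (Metric.closedBall_subset_ball hr.2))).trans_eq (extIntegral_congr_ae ?_)
    filter_upwards [ae_circleProb_norm_eq_one] with ζ hζ
    rw [zero_add, Set.indicator_of_mem]
    rw [mem_ball_zero_iff, norm_mul, hζ, mul_one, Complex.norm_real, Real.norm_of_nonneg hr.1.le]
    exact hr.2

/-! ### Testing the Riesz measure. -/

theorem lintegral_smoothLog_le (hEne : E.Nonempty)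
    (hE : E ⊆ Metric.sphere (0 : ℂ) 1) (hFne : F.Nonempty) (hF : F ⊆ Metric.sphere (0 : ℂ) 1)
    (hp : 0 < p) (hq : 0 < q) (hM : 0 < M) (hint : singularNorm E F p q < ⊤)
    {v : ℂ → EReal} (hv : InGrowthClass E F p q M v) (hv0 : 0 ≤ v 0)
    {μ : Measure ℂ} (hμ : IsRieszMeasure v (Metric.ball 0 1) μ)
    {δ : ℝ} (hδ : 0 < δ) (hδ' : 2 * δ < 1) :
    ∫⁻ z in Metric.ball (0 : ℂ) 1, ENNReal.ofReal (smoothLog δ (‖z‖ ^ 2)) ∂μ ≤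
      circleMeanBound E F p q M √(1 - 2 * δ) := by
  set B := circleMeanBound E F p q M with hB
  have hBtop : ∀ r, B r ≠ ⊤ := fun r => (circleMeanBound_lt_top hint r).ne
  have hBanti : ∀ {r s : ℝ}, 0 < r → r ≤ s → (B s).toReal ≤ (B r).toReal := fun hr hrs =>
    ENNReal.toReal_mono (hBtop _) (circleMeanBound_anti hp hq hr hrs)
  have hmean := fun r hr =>
    circle_mean_bounds hEne hE hFne hF hp hq hM hint hv hv0 (r := r) hr
  set w : ℂ → ℝ := fun z => ((Metric.ball (0 : ℂ) 1).indicator v z).toReal with hw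
  have hwm : Measurable w := measurable_ereal_toReal.comp
    (hv.subharmonic.upperSemicontinuousOn.measurable_indicator measurableSet_ball)
  set g : ℝ → ℝ := fun r => -4 * deriv (fluxProfile δ) (r ^ 2) with hg
  have hgc : Continuous g :=
    continuous_const.mul (continuous_deriv_fluxProfile.comp (continuous_pow 2))
  obtain ⟨G, hG⟩ := (isCompact_Icc (a := (0 : ℝ)) (b := 1)).exists_bound_of_continuousOn
    hgc.continuousOn
  have hG0 : 0 ≤ G := (norm_nonneg _).trans (hG 0 (by simp))
  -- The bound `B r` may blow up as `r → 0`, but `g` vanishes for `r ^ 2 < δ`.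
  have hC : ∀ r ∈ Set.Ioo (0 : ℝ) 1, |g r| * ∫ ζ, ‖w (r * ζ)‖ ∂circleProb ≤
      G * (2 * (B √δ).toReal) := by
    intro r hr
    rcases lt_or_ge (r ^ 2) δ with h | h
    · simp only [hg, deriv_fluxProfile_of_lt hδ h, mul_zero, abs_zero, zero_mul]
      positivity
    · refine mul_le_mul (hG r ⟨hr.1.le, hr.2.le⟩) ((hmean r hr).2.2.2.trans ?_)
        (integral_nonneg fun _ => norm_nonneg _) hG0
      refine mul_le_mul_of_nonneg_left (hBanti (Real.sqrt_pos.2 hδ) ?_) two_pos.le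
      exact (Real.sqrt_le_left hr.1.le).2 h
  obtain ⟨hrint, hradial⟩ := setIntegral_ball_mul_radial hwm hgc.measurable
    (fun r hr => (hmean r hr).1) hC
  have hcd : Continuous (deriv (innerCutoff δ)) :=
    (contDiff_innerCutoff (δ := δ)).continuous_deriv (by simp)
  have hpt : ∀ r ∈ Set.Ioo (0 : ℝ) 1, r * (g r * ∫ ζ, w (r * ζ) ∂circleProb) ≤
      (B √(1 - 2 * δ)).toReal * (r * (2 * deriv (innerCutoff δ) (1 - r ^ 2))) := by
    intro r hr
    obtain ⟨-, h0, h1, -⟩ := hmean r hr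
    have hD := deriv_innerCutoff_nonneg hδ (1 - r ^ 2)
    have h2 : g r ≤ 2 * deriv (innerCutoff δ) (1 - r ^ 2) := by
      have := neg_deriv_fluxProfile_le hδ (r ^ 2)
      simp only [hg]
      linarith
    -- The weight lives on `r ≥ √(1 - 2 * δ)`, where `B` is largest at the left end.
    have h3 : 2 * deriv (innerCutoff δ) (1 - r ^ 2) * ∫ ζ, w (r * ζ) ∂circleProb ≤
        2 * deriv (innerCutoff δ) (1 - r ^ 2) * (B √(1 - 2 * δ)).toReal := by
      rcases lt_or_ge (2 * δ) (1 - r ^ 2) with h | h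
      · simp [deriv_innerCutoff_of_gt hδ h]
      · refine mul_le_mul_of_nonneg_left (h1.trans (hBanti (Real.sqrt_pos.2 (by linarith)) ?_))
          (by positivity)
        exact (Real.sqrt_le_left hr.1.le).2 (by linarith)
    -- Discarding the inner transition through `h2` is legitimate because the mean is nonnegative.
    have h4 := (mul_le_mul_of_nonneg_right h2 h0).trans h3
    calc _ ≤ r * (2 * deriv (innerCutoff δ) (1 - r ^ 2) * (B √(1 - 2 * δ)).toReal) :=
          mul_le_mul_of_nonneg_left h4 hr.1.le
      _ = _ := by ring
  have hbound : ∫ r in Set.Ioo (0 : ℝ) 1, r * (g r * ∫ ζ, w (r * ζ) ∂circleProb) ≤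
      (B √(1 - 2 * δ)).toReal := by
    refine (setIntegral_mono_on hrint ?_ measurableSet_Ioo hpt).trans_eq ?_
    · exact (Continuous.integrableOn_Icc (by fun_prop)).mono_set Set.Ioo_subset_Icc_self
    · rw [integral_const_mul, ← integral_Ioc_eq_integral_Ioo,
        ← intervalIntegral.integral_of_le zero_le_one, integral_deriv_innerCutoff hδ hδ'.le,
        mul_one]
  have hφint : IntegrableOn (fun z : ℂ => smoothLog δ (‖z‖ ^ 2)) (Metric.ball 0 1) μ := by
    have hK : IntegrableOn (fun z : ℂ => smoothLog δ (‖z‖ ^ 2))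
        (Metric.closedBall 0 √(1 - δ)) μ := by
      have hfin := hμ.finite_on_compacts _ (isCompact_closedBall 0 √(1 - δ))
        (closedBall_sqrt_subset_ball hδ)
      obtain ⟨c, hc⟩ := (isCompact_closedBall (0 : ℂ) √(1 - δ)).exists_bound_of_continuousOn
        (contDiff_smoothLog_norm_sq hδ).continuous.continuousOn
      refine Measure.integrableOn_of_bounded (M := c) hfin.ne
        (contDiff_smoothLog_norm_sq hδ).continuous.aestronglyMeasurable ?_
      exact (ae_restrict_iff' Metric.isClosed_closedBall.measurableSet).2
        (Filter.Eventually.of_forall hc)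
    refine hK.of_forall_sdiff_eq_zero measurableSet_ball fun z hz => ?_
    by_contra h
    exact hz.2 (tsupport_smoothLog_norm_sq hδ (subset_tsupport _ h))
  rw [← ofReal_integral_eq_lintegral_ofReal hφint, hμ.integral_eq _
    (contDiff_smoothLog_norm_sq hδ) (hasCompactSupport_smoothLog_norm_sq hδ)
    ((tsupport_smoothLog_norm_sq hδ).trans (closedBall_sqrt_subset_ball hδ)),
    setIntegral_congr_fun (g := fun z => w z * g ‖z‖) measurableSet_ball, hradial,
    inv_mul_cancel_left₀ Real.two_pi_pos.ne']
  · exact ENNReal.ofReal_le_of_le_toReal hbound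
  · intro z hz
    simp only [hw, hg, laplacian_smoothLog hδ, Set.indicator_of_mem hz]
  · refine (ae_restrict_iff' measurableSet_ball).2 (Filter.Eventually.of_forall fun z hz => ?_)
    rw [mem_ball_zero_iff] at hz
    exact smoothLog_nonneg (sq_nonneg _) (pow_le_one₀ (norm_nonneg _) hz.le)

end

/-! ### The limit `δ → 0`. -/

theorem mainTheorem3 (E F : Set ℂ)
    (hE : IsCompact E) (hE_ne : E.Nonempty) (hE_sub : E ⊆ Metric.sphere (0 : ℂ) 1)
    (hF : IsCompact F) (hF_ne : F.Nonempty) (hF_sub : F ⊆ Metric.sphere (0 : ℂ) 1)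
    (p q M : ℝ) (hp : 0 < p) (hq : 0 < q) (hM : 0 < M)
    (hint : singularNorm E F p q < ⊤)
    (v : ℂ → EReal) (hv : InGrowthClass E F p q M v) (hv0 : 0 ≤ v 0)
    (μ : Measure ℂ) (hμ : IsRieszMeasure v (Metric.ball 0 1) μ) :
    ∫⁻ z in Metric.ball (0 : ℂ) 1, ENNReal.ofReal (1 - ‖z‖) ∂μ
      ≤ ENNReal.ofReal M * singularNorm E F p q := by
  set δ : ℕ → ℝ := fun n => 1 / ((n : ℝ) + 1) / 4 with hδdef
  have hδ : ∀ n, 0 < δ n := fun n => by positivity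
  have hδ1 : ∀ n, 2 * δ n < 1 := fun n => by
    have : 1 / ((n : ℝ) + 1) ≤ 1 := by
      rw [div_le_one (by positivity)]
      linarith [n.cast_nonneg (α := ℝ)]
    simp only [hδdef]
    linarith
  have hδ0 : Filter.Tendsto δ Filter.atTop (nhds 0) := by
    simpa [hδdef] using (tendsto_one_div_add_atTop_nhds_zero_nat (𝕜 := ℝ)).div_const 4
  -- This explicit minorant of the test function already converges to `1 - ‖z‖`, so the logarithm
  -- itself is never needed.
  set ψ : ℕ → ℂ → ENNReal := fun n z =>
    ENNReal.ofReal (√(1 - 2 * δ n) - √(‖z‖ ^ 2 + 2 * δ n)) with hψ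
  have hψm : ∀ n, Measurable (ψ n) := fun n =>
    ENNReal.measurable_ofReal.comp (Continuous.measurable (by fun_prop))
  have hψlim : ∀ z, Filter.Tendsto (fun n => ψ n z) Filter.atTop
      (nhds (ENNReal.ofReal (1 - ‖z‖))) := by
    intro z
    have hc : Continuous fun t : ℝ =>
        ENNReal.ofReal (√(1 - 2 * t) - √(‖z‖ ^ 2 + 2 * t)) :=
      ENNReal.continuous_ofReal.comp (by fun_prop)
    have := (hc.tendsto 0).comp hδ0
    simpa [Function.comp_def, Real.sqrt_sq (norm_nonneg z)] using this
  have hψle : ∀ n, ∫⁻ z in Metric.ball (0 : ℂ) 1, ψ n z ∂μ ≤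
      circleMeanBound E F p q M √(1 - 2 * δ n) := by
    intro n
    refine (setLIntegral_mono' measurableSet_ball fun z hz => ?_).trans
      (lintegral_smoothLog_le hE_ne hE_sub hF_ne hF_sub hp hq hM hint hv hv0 hμ (hδ n) (hδ1 n))
    rw [mem_ball_zero_iff] at hz
    exact ENNReal.ofReal_le_ofReal (sqrt_sub_sqrt_le_smoothLog (hδ n) (sq_nonneg _)
      (pow_le_one₀ (norm_nonneg _) hz.le))
  have hBlim : Filter.Tendsto (fun n => circleMeanBound E F p q M √(1 - 2 * δ n)) Filter.atTop
      (nhds (ENNReal.ofReal M * singularNorm E F p q)) := by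
    -- One root is the radius, the other comes from `√r` in `circleMeanBound`.
    have hs : Filter.Tendsto (fun n => √√(1 - 2 * δ n)) Filter.atTop (nhds 1) := by
      have hc : Continuous fun t : ℝ => √√(1 - 2 * t) := by fun_prop
      simpa [Function.comp_def] using (hc.tendsto 0).comp hδ0
    have h1 := ENNReal.tendsto_ofReal
      (hs.rpow_const (p := -(p + q)) (Or.inl one_ne_zero))
    rw [Real.one_rpow, ENNReal.ofReal_one] at h1
    have h2 := ENNReal.Tendsto.mul_const (b := ENNReal.ofReal M * singularNorm E F p q) h1
      (Or.inl one_ne_zero)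
    rwa [one_mul] at h2
  -- Fatou's lemma suffices, so `μ` need not be finite on the disk.
  calc ∫⁻ z in Metric.ball (0 : ℂ) 1, ENNReal.ofReal (1 - ‖z‖) ∂μ
      = ∫⁻ z in Metric.ball (0 : ℂ) 1, Filter.liminf (fun n => ψ n z) Filter.atTop ∂μ :=
        lintegral_congr fun z => (hψlim z).liminf_eq.symm
    _ ≤ Filter.liminf (fun n => ∫⁻ z in Metric.ball (0 : ℂ) 1, ψ n z ∂μ) Filter.atTop :=
        lintegral_liminf_le hψm
    _ ≤ Filter.liminf (fun n => circleMeanBound E F p q M √(1 - 2 * δ n)) Filter.atTop :=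
        Filter.liminf_le_liminf (Filter.Eventually.of_forall hψle)
    _ = ENNReal.ofReal M * singularNorm E F p q := hBlim.liminf_eq
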